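/- Let $\mathcal G=(\mathcal V,\mathcal E)$ be a finite acyclic directed graph (no directed cycles, in particular no self-loops; $(i,j)\in\mathcal E$ is an edge from $i$ to $j$). Let $\mathcal N_j^-$ and $\mathcal N_j^+$ be the sets of in-neighbours and out-neighbours of $j$. For $\mathcal X,\mathcal Y\subseteq\mathcal V$ let $b_{\mathcal X\to\mathcal Y}$ be the maximum number of mutually vertex-disjoint directed paths from $\mathcal X$ to $\mathcal Y$. Disjointness includes the end vertices, every vertex appears at most once on a path, and a single vertex of $\mathcal X\cap\mathcal Y$ counts as a path of length zero. Consider a network model set on $\mathcal G$ with parameters $\theta\in\Theta\subseteq\mathbb R^p$. For each $\theta\in\Theta$ there is a matrix $G(q,\theta)$ over $\mathbb R(q)$ with $G_{ji}=0$ if $(i,j)\notin\mathcal E$, and the modules $G_{ji}$, $e=(i,j)\in\mathcal E$, are parameterized independently, in the following sense. The scalar parameters are distributed over the edges, so that $\theta$ is split into blocks $(\theta_e)_{e\in\mathcal E}$, and $G_{ji}(q,\theta)=N_e(q,\theta)/D_e(q,\theta)$. Here $N_e,D_e$ are polynomials in $q$ whose coefficients are real-analytic functions of $\theta$ on a connected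 open set $U\supseteq\Theta$ and depend only on the block $\theta_e$, and $D_e(\cdot,\theta)\ne0$ for $\theta\in\Theta$. No module is the same transfer function for all $\theta\in\Theta$. Put $T(q,\theta)=(I-G(q,\theta))^{-1}$. Let $\mathcal R,\mathcal C\subseteq\mathcal V$ be the sets of excited and of measured vertices, with $\mathcal R\cup\mathcal C=\mathcal V$, and let $R=[I]_{\star,\mathcal R}$ and $C=[I]_{\mathcal C,\star}$ be the corresponding columns and rows of the identity matrix, so that $CTR=[T]_{\mathcal C,\mathcal R}$. Suppose that: 1. every measured vertex $j$ satisfies $b_{\mathcal R\to\mathcal N_j^-}=|\mathcal N_j^-|$; 2. for every unmeasured (hence excited) vertex $j$ there are a set of measured vertices $\mathcal C_j\subseteq\mathcal C$ and a set of excited vertices $\mathcal R_j\subseteq\mathcal R$ such that $\widehat{\mathcal N}_j^-\subseteq\mathcal C_j$, $j\in\mathcal R_j$, and $$b_{\mathcal R_j\to\mathcal C_j}=|\mathcal R_j|,\qquad b_{(\mathcal R_j\cup\mathcal S_j)\setminus\{j\}\to\mathcal C_j}=|\mathcal R_j|-1,$$ where $\widehat{\mathcal N}_j^-=\mathcal N_j^-\setminus\mathcal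 R$ is the set of unexcited in-neighbours of $j$ and $\mathcal S_j=\widehat{\mathcal N}_j^-\cup\bigcup_{i\in\mathcal N_j^-}\mathcal N_i^+$. Then the model set is generically identifiable from $[T]_{\mathcal C,\mathcal R}$: for every edge $(i,j)\in\mathcal E$ and all $\theta_0\in\Theta$ outside a set of Lebesgue measure zero, every $\theta_1\in\Theta$ with $CT(q,\theta_1)R=CT(q,\theta_0)R$ satisfies $G_{ji}(q,\theta_1)=G_{ji}(q,\theta_0)$. -/

import Mathlib

open scoped Polynomial

namespace DynNet

/-! ### Directed graphs: neighbours, acyclicity, vertex-disjoint paths.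
`𝒢.Adj i j` means that `(i, j)` is an edge, directed from `i` to `j`. -/

/-- No directed cycle; in particular no self-loop, so an acyclic graph is simple. -/
def IsAcyclic {V : Type*} (𝒢 : Digraph V) : Prop :=
  ∀ v, ¬ Relation.TransGen 𝒢.Adj v v

/-- The edge set of `𝒢`. -/
abbrev Edge {V : Type*} (𝒢 : Digraph V) : Type _ := {e : V × V // 𝒢.Adj e.1 e.2}

open Classical in
/-- The in-neighbours of `j`. -/
noncomputable def inNbrs {V : Type*} [Fintype V] (𝒢 : Digraph V) (j : V) : Finset V :=
  Finset.univ.filter fun i => 𝒢.Adj i j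

open Classical in
/-- The out-neighbours of `i`. -/
noncomputable def outNbrs {V : Type*} [Fintype V] (𝒢 : Digraph V) (i : V) : Finset V :=
  Finset.univ.filter fun j => 𝒢.Adj i j

/-- `p` lists the successive vertices of a directed path that starts in `U` and ends in `Y`.
Every vertex appears at most once; a single vertex of `U ∩ Y` is a path of length zero. -/
def IsPath {V : Type*} (𝒢 : Digraph V) (U Y : Finset V) (p : List V) : Prop :=
  p.IsChain 𝒢.Adj ∧ p.Nodup ∧ (∃ u ∈ U, p.head? = some u) ∧ (∃ y ∈ Y, p.getLast? = some y)

/-- There are `n` mutually vertex-disjoint (endpoints included) directed paths from `U` to `Y`. -/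
def HasDisjointPaths {V : Type*} (𝒢 : Digraph V) (U Y : Finset V) (n : ℕ) : Prop :=
  ∃ p : Fin n → List V, (∀ k, IsPath 𝒢 U Y (p k)) ∧
    Pairwise fun k l => List.Disjoint (p k) (p l)

/-- `b_{U → Y}`: the maximum number of mutually vertex-disjoint paths from `U` to `Y`. -/
noncomputable def maxDisjointPaths {V : Type*} (𝒢 : Digraph V) (U Y : Finset V) : ℕ :=
  sSup {n | HasDisjointPaths 𝒢 U Y n}

/-- The supremum in `maxDisjointPaths` is over a bounded set ... -/
theorem bddAbove_hasDisjointPaths {V : Type*} (𝒢 : Digraph V) (U Y : Finset V) :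
    BddAbove {n | HasDisjointPaths 𝒢 U Y n} := by
  refine ⟨U.card, ?_⟩
  rintro n ⟨p, hp, hd⟩
  choose u hu hpu using fun k => (hp k).2.2.1
  have hinj : Function.Injective u := by
    intro k l hkl
    by_contra hne
    refine hd hne (List.mem_of_mem_head? (hpu k)) ?_
    rw [hkl]
    exact List.mem_of_mem_head? (hpu l)
  simpa using Finset.card_le_card_of_injOn (s := Finset.univ) (t := U) u
    (fun k _ => hu k) hinj.injOn

/-- ... and it is attained. -/
theorem hasDisjointPaths_maxDisjointPaths {V : Type*} (𝒢 : Digraph V) (U Y : Finset V) :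
    HasDisjointPaths 𝒢 U Y (maxDisjointPaths 𝒢 U Y) :=
  Nat.sSup_mem (s := {n | HasDisjointPaths 𝒢 U Y n})
    ⟨0, fun k => k.elim0, fun k => k.elim0, fun k => k.elim0⟩
    (bddAbove_hasDisjointPaths 𝒢 U Y)

/-! ### Network model sets -/

/-- The independently parameterized modules of a network model set with topology `𝒢`.

The parameter vector is `θ ∈ Θ ⊆ ℝ^p`. Each scalar parameter belongs to one edge, so that `θ` is
split into blocks `θ_e`, one for each edge `e`, and the module on `e` is
`N_e(q, θ_e) / D_e(q, θ_e)` with `N_e`, `D_e` polynomials in `q` whose coefficients are real-analytic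
functions of `θ_e` on a domain `U ⊇ Θ`. Every module is really parameterized: it is
not one and the same transfer function for all `θ ∈ Θ`. Since `Θ` is an arbitrary subset of `U`,
it may be the set of parameters at which the network is proper, stable and well-posed. -/
structure ModelSet {V : Type*} (𝒢 : Digraph V) where
  /-- number `p` of scalar parameters -/
  p : ℕ
  /-- the edge to which a scalar parameter belongs -/
  owner : Fin p → Edge 𝒢
  /-- the domain on which the coefficients are analytic -/
  U : Set (Fin p → ℝ)
  isOpen_U : IsOpen U
  isPreconnected_U : IsPreconnected U
  /-- the parameter set -/
  Θ : Set (Fin p → ℝ)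
  Θ_subset : Θ ⊆ U
  num : Edge 𝒢 → (Fin p → ℝ) → ℝ[X]
  den : Edge 𝒢 → (Fin p → ℝ) → ℝ[X]
  analytic_num : ∀ e m, AnalyticOnNhd ℝ (fun θ => (num e θ).coeff m) U
  analytic_den : ∀ e m, AnalyticOnNhd ℝ (fun θ => (den e θ).coeff m) U
  /-- the module on `e` depends only on the block of parameters belonging to `e` -/
  independent : ∀ e, ∀ θ ∈ U, ∀ θ' ∈ U, (∀ k, owner k = e → θ k = θ' k) →
    num e θ = num e θ' ∧ den e θ = den e θ'
  den_ne_zero : ∀ e, ∀ θ ∈ Θ, den e θ ≠ 0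
  nonconstant : ∀ e, ∃ θ ∈ Θ, ∃ θ' ∈ Θ, num e θ * den e θ' ≠ num e θ' * den e θ

/-- The transfer function of the module on the edge `e`, an element of `ℝ(q)`. -/
noncomputable def ModelSet.module {V : Type*} {𝒢 : Digraph V} (M : ModelSet 𝒢) (e : Edge 𝒢)
    (θ : Fin M.p → ℝ) : RatFunc ℝ :=
  algebraMap ℝ[X] (RatFunc ℝ) (M.num e θ) / algebraMap ℝ[X] (RatFunc ℝ) (M.den e θ)

open Classical in
/-- The network matrix `G(q, θ)`: the entry `G_{ji}` is the module on the edge `(i, j)`, and zero if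
there is no such edge. -/
noncomputable def ModelSet.G {V : Type*} {𝒢 : Digraph V} (M : ModelSet 𝒢)
    (θ : Fin M.p → ℝ) : Matrix V V (RatFunc ℝ) :=
  fun j i => if h : 𝒢.Adj i j then M.module ⟨(i, j), h⟩ θ else 0

/-- `T(q, θ) = (I - G(q, θ))⁻¹`. -/
noncomputable def ModelSet.T {V : Type*} [Fintype V] [DecidableEq V] {𝒢 : Digraph V}
    (M : ModelSet 𝒢) (θ : Fin M.p → ℝ) : Matrix V V (RatFunc ℝ) :=
  (1 - M.G θ)⁻¹

/-- The excitation matrix `R`: the columns of the identity matrix indexed by `R`. -/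
noncomputable def excitationMatrix {V : Type*} [DecidableEq V] (R : Finset V) :
    Matrix V R (RatFunc ℝ) :=
  (1 : Matrix V V (RatFunc ℝ)).submatrix id Subtype.val

/-- The measurement matrix `C`: the rows of the identity matrix indexed by `C`. -/
noncomputable def measurementMatrix {V : Type*} [DecidableEq V] (C : Finset V) :
    Matrix C V (RatFunc ℝ) :=
  (1 : Matrix V V (RatFunc ℝ)).submatrix Subtype.val id

/-- The transfer matrix `C T(q, θ) R` from the excitation signals to the measured signals. -/
noncomputable def ModelSet.measuredTransfer {V : Type*} [Fintype V] [DecidableEq V]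
    {𝒢 : Digraph V} (M : ModelSet 𝒢) (R C : Finset V) (θ : Fin M.p → ℝ) :
    Matrix C R (RatFunc ℝ) :=
  measurementMatrix C * M.T θ * excitationMatrix R

/-- `G_{ji}` is generically identifiable: for all `θ₀ ∈ Θ` outside a set of Lebesgue measure zero,
any `θ₁ ∈ Θ` with the same `C T R` has the same `G_{ji}`. -/
def ModelSet.ModuleGenericallyIdentifiable {V : Type*} [Fintype V] [DecidableEq V]
    {𝒢 : Digraph V} (M : ModelSet 𝒢) (R C : Finset V) (j i : V) : Prop :=
  ∀ᵐ θ₀ ∂(MeasureTheory.volume : MeasureTheory.Measure (Fin M.p → ℝ)), θ₀ ∈ M.Θ →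
    ∀ θ₁ ∈ M.Θ, M.measuredTransfer R C θ₁ = M.measuredTransfer R C θ₀ →
      M.G θ₁ j i = M.G θ₀ j i

/-- The model set is generically identifiable: all its modules are. -/
def ModelSet.GenericallyIdentifiable {V : Type*} [Fintype V] [DecidableEq V]
    {𝒢 : Digraph V} (M : ModelSet 𝒢) (R C : Finset V) : Prop :=
  ∀ i j, 𝒢.Adj i j → M.ModuleGenericallyIdentifiable R C j i

/-- The unexcited in-neighbours of `j`. -/
noncomputable def unexcitedInNbrs {V : Type*} [Fintype V] [DecidableEq V] (𝒢 : Digraph V)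
    (R : Finset V) (j : V) : Finset V :=
  inNbrs 𝒢 j \ R

/-- `S_j`: the unexcited in-neighbours of `j` together with all the out-neighbours of the
in-neighbours of `j`. -/
noncomputable def auxSet {V : Type*} [Fintype V] [DecidableEq V] (𝒢 : Digraph V)
    (R : Finset V) (j : V) : Finset V :=
  unexcitedInNbrs 𝒢 R j ∪ (inNbrs 𝒢 j).biUnion (outNbrs 𝒢)

end DynNet

/-! Let `A = G(θ₀)` and `B = G(θ₁)`, with inverses `T` that agree on the rows `C` and the columns
`R`. By induction along the acyclic order, row `j` of `B` equals row `j` of `A`, and the two `T`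
agree in row `j` on `R` (`eq_of_inv_eq`). For measured `j`, `T = 1 + G T` expands `T_{j,R}` in the
rows of the in-neighbours, which agree by induction and are independent over `R`. For unmeasured
`j`, take a functional `φ` that sees only the rows `C_j` and is dual to column `j` among the columns
`R_j`. By an exchange argument `φ` kills every column of `S_j` other than `j`, so `T = 1 + T G`
yields `G_{ji} = φ(T e_i) - φ(e_i)`. The first term is common to both models if `i` is excited, and
zero if it is not.

Two facts relate rank and paths. Independent columns always give as many disjoint paths, by Hall's
theorem (`IsNetworkMatrix.hasDisjointPaths`); this holds at every parameter and gives the exchange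
argument for `A` and `B` alike. Conversely, disjoint paths make a minor of `T` nonzero for almost
every `θ` (`ModelSet.exists_minor_ae_ne_zero`). Weight one on the paths makes the minor 1; a
bordered determinant, affine in each module, then stays nonzero for some choice between two values
of each module; independent blocks realize that choice; and an analytic function that is not
identically zero has a null zero set. Genericity is thus needed of `θ₀` only. -/

/-! ### Zero sets of real-analytic functions -/

section AnalyticZeros

open MeasureTheory Filter Topology

variable {E : Type*} [NormedAddCommGroup E] [NormedSpace ℝ E] [FiniteDimensional ℝ E]
  [MeasurableSpace E] [BorelSpace E] (μ : Measure E) [μ.IsAddHaarMeasure]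

/-- The zeros of an analytic function on a ball about the origin are null if the function does
not vanish at the centre: almost every dilation of the zero set is null by Fubini along rays. -/
theorem AnalyticOnNhd.measure_zeros_ball_zero {f : E → ℝ} {r : ℝ} (hr : 0 < r)
    (hf : AnalyticOnNhd ℝ f (Metric.ball 0 r)) (h0 : f 0 ≠ 0) :
    μ {x | x ∈ Metric.ball 0 r ∧ f x = 0} = 0 := by
  set Z : Set E := {x | x ∈ Metric.ball 0 r ∧ f x = 0} with hZ
  have hZm : MeasurableSet Z := by
    have h : Z = Metric.ball 0 r \ (Metric.ball 0 r ∩ f ⁻¹' {0}ᶜ) := by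
      ext x
      simp only [hZ, Set.mem_ofPred_eq, Set.mem_sdiff, Set.mem_inter_iff, Set.mem_preimage,
        Set.mem_compl_iff, Set.mem_singleton_iff]
      tauto
    rw [h]
    exact Metric.isOpen_ball.measurableSet.diff (hf.continuousOn.isOpen_inter_preimage
      Metric.isOpen_ball isOpen_compl_singleton).measurableSet
  have hray : ∀ x : E, ∀ᵐ t : ℝ, t • x ∉ Z := by
    intro x
    have hcont : Continuous fun t : ℝ => t • x := by fun_prop
    set W : Set ℝ := (fun t : ℝ => t • x) ⁻¹' Metric.ball 0 r with hW
    have hWo : IsOpen W := Metric.isOpen_ball.preimage hcont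
    have hWc : Convex ℝ W :=
      (convex_ball (0 : E) r).linear_preimage (LinearMap.toSpanSingleton ℝ E x)
    have h0W : (0 : ℝ) ∈ W := by simpa [hW] using hr
    have hg : AnalyticOnNhd ℝ (f ∘ fun t : ℝ => t • x) W :=
      hf.comp (fun t _ => analyticAt_id.smul analyticAt_const) (fun t ht => ht)
    have h := ae_restrict_le_codiscreteWithin (μ := volume) hWo.measurableSet
      (hg.preimage_zero_mem_codiscreteWithin (x := 0) (by simpa using h0) h0W
        ⟨⟨0, h0W⟩, hWc.isPreconnected⟩)
    filter_upwards [(ae_restrict_iff' hWo.measurableSet).1 h] with t ht htZ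
    exact ht htZ.1 htZ.2
  have hswap : ∀ᵐ t : ℝ, ∀ᵐ x ∂μ, t • x ∉ Z := by
    refine (Measure.ae_ae_comm (p := fun (t : ℝ) (x : E) => t • x ∉ Z) ?_).2
      (Eventually.of_forall hray)
    have hm : Measurable fun z : ℝ × E => z.1 • z.2 := by fun_prop
    exact hm hZm.compl
  have hne : ∀ᵐ t : ℝ, t ≠ 0 := by simp [ae_iff]
  -- One nonzero dilation with null preimage suffices, since Haar measure scales by a nonzero
  -- factor.
  obtain ⟨t, ht, ht0⟩ := (hswap.and hne).exists
  have h := Measure.addHaar_preimage_smul μ ht0 Z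
  have hz : μ ((fun x => t • x) ⁻¹' Z) = 0 := by
    simp only [ae_iff, not_not] at ht
    exact ht
  rw [hz, eq_comm, mul_eq_zero] at h
  refine h.resolve_left ?_
  simp only [ENNReal.ofReal_eq_zero, not_le]
  positivity

theorem AnalyticOnNhd.measure_zeros_ball {f : E → ℝ} {y : E} {r : ℝ} (hr : 0 < r)
    (hf : AnalyticOnNhd ℝ f (Metric.ball y r)) (h0 : f y ≠ 0) :
    μ {x | x ∈ Metric.ball y r ∧ f x = 0} = 0 := by
  have hg : AnalyticOnNhd ℝ (f ∘ fun x => y + x) (Metric.ball 0 r) :=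
    hf.comp (fun x _ => analyticAt_const.add analyticAt_id) (fun x hx => by simpa using hx)
  have h := hg.measure_zeros_ball_zero μ hr (by simpa using h0)
  rw [← measure_preimage_add μ y]
  simpa using h

/-- A nonzero analytic function on a connected open set vanishes almost nowhere. -/
theorem AnalyticOnNhd.ae_ne_zero {f : E → ℝ} {U : Set E} (hU : IsOpen U) (hc : IsPreconnected U)
    (hf : AnalyticOnNhd ℝ f U) {y : E} (hy : y ∈ U) (hfy : f y ≠ 0) :
    ∀ᵐ x ∂μ, x ∈ U → f x ≠ 0 := by
  rw [ae_iff]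
  refine measure_null_of_locally_null _ fun x hx => ?_
  have hxU : x ∈ U := by
    by_contra h
    exact hx fun h' => absurd h' h
  obtain ⟨r, hr, hrU⟩ := Metric.isOpen_iff.1 hU x hxU
  -- The identity theorem gives such a `z`. With radius `r / 2` the ball about `z` contains `x` and
  -- stays inside `U`.
  obtain ⟨z, hz, hfz⟩ : ∃ z ∈ Metric.ball x (r / 2), f z ≠ 0 := by
    by_contra! hcon
    refine hfy (hf.eqOn_zero_of_preconnected_of_eventuallyEq_zero hc hxU ?_ hy)
    filter_upwards [Metric.ball_mem_nhds x (half_pos hr)] with w hw using hcon w hw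
  have hsub : Metric.ball z (r / 2) ⊆ U := fun w hw => hrU <| by
    rw [Metric.mem_ball] at hw hz ⊢
    linarith [dist_triangle w z x]
  refine ⟨_, ?_, (hf.mono hsub).measure_zeros_ball μ (half_pos hr) hfz⟩
  refine mem_nhdsWithin.2 ⟨Metric.ball z (r / 2), Metric.isOpen_ball, ?_, ?_⟩
  · rwa [Metric.mem_ball_comm]
  · rintro w ⟨hw, hw'⟩
    refine ⟨hw, ?_⟩
    by_contra h
    exact hw' fun _ => h

end AnalyticZeros

namespace DynNet

/-! ### Heights and disjoint paths -/

section Paths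

variable {V : Type*} {𝒢 : Digraph V}

/-- The height counts proper ancestors: along an edge `i → j` the ancestors persist, and `i` itself
is new by acyclicity. -/
theorem IsAcyclic.exists_height [Finite V] (h : IsAcyclic 𝒢) :
    ∃ ht : V → ℕ, ∀ i j, 𝒢.Adj i j → ht i < ht j := by
  classical
  have := Fintype.ofFinite V
  refine ⟨fun v => (Finset.univ.filter fun u => Relation.TransGen 𝒢.Adj u v).card,
    fun i j hij => Finset.card_lt_card ?_⟩
  refine Finset.ssubset_iff_of_subset (fun u hu => ?_) |>.2 ⟨i, ?_, ?_⟩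
  · simp only [Finset.mem_filter_univ] at hu ⊢
    exact hu.tail hij
  · simpa using Relation.TransGen.single hij
  · simpa using h i

theorem HasDisjointPaths.mono {X X' Y Y' : Finset V} {n : ℕ} (hX : X ⊆ X') (hY : Y ⊆ Y')
    (h : HasDisjointPaths 𝒢 X Y n) : HasDisjointPaths 𝒢 X' Y' n := by
  obtain ⟨p, hp, hd⟩ := h
  refine ⟨p, fun k => ?_, hd⟩
  obtain ⟨h1, h2, ⟨u, hu, hu'⟩, ⟨y, hy, hy'⟩⟩ := hp k
  exact ⟨h1, h2, ⟨u, hX hu, hu'⟩, ⟨y, hY hy, hy'⟩⟩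

theorem le_maxDisjointPaths {X Y : Finset V} {n : ℕ} (h : HasDisjointPaths 𝒢 X Y n) :
    n ≤ maxDisjointPaths 𝒢 X Y :=
  le_csSup (bddAbove_hasDisjointPaths 𝒢 X Y) h

/-- A relation in which predecessors are unique, `X` has no predecessors, and every vertex of `X`
or with a predecessor is in `Y` or has a successor, splits into disjoint paths. -/
theorem hasDisjointPaths_of_relation {ht : V → ℕ} (hht : ∀ i j, 𝒢.Adj i j → ht i < ht j)
    {X Y : Finset V} {N : ℕ} (hN : ∀ v, ht v ≤ N) {r : V → V → Prop}
    (hadj : ∀ a b, r a b → 𝒢.Adj a b) (hinj : ∀ a a' b, r a b → r a' b → a = a')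
    (hX : ∀ a b, r a b → b ∉ X)
    (hstep : ∀ v, (v ∈ X ∨ ∃ a, r a v) → v ∈ Y ∨ ∃ b, r v b) :
    HasDisjointPaths 𝒢 X Y X.card := by
  have hex : ∀ n v, N - ht v ≤ n → (v ∈ X ∨ ∃ a, r a v) → ∃ p : List V,
      p.IsChain r ∧ p.head? = some v ∧ ∃ y ∈ Y, p.getLast? = some y := by
    intro n
    induction n with
    | zero =>
      intro v hv hs
      rcases hstep v hs with hy | ⟨b, hb⟩
      · exact ⟨[v], by simp, by simp, v, hy, by simp⟩
      · have := hht _ _ (hadj _ _ hb)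
        have := hN b
        omega
    | succ n ih =>
      intro v hv hs
      rcases hstep v hs with hy | ⟨b, hb⟩
      · exact ⟨[v], by simp, by simp, v, hy, by simp⟩
      · have := hht _ _ (hadj _ _ hb)
        have := hN b
        obtain ⟨p, hp, hhead, y, hy, hlast⟩ := ih b (by omega) (Or.inr ⟨v, hb⟩)
        refine ⟨v :: p, ?_, by simp, y, hy, ?_⟩
        · rw [List.isChain_cons]
          refine ⟨fun z hz => ?_, hp⟩
          rw [hhead] at hz
          cases hz
          exact hb
        · cases p with
          | nil => simp at hhead
          | cons c p => rw [List.getLast?_cons_cons]; exact hlast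
  have hreach : ∀ {p : List V} {v z : V}, p.IsChain r → p.head? = some v → z ∈ p →
      Relation.ReflTransGen r v z := by
    intro p
    induction p with
    | nil => intro v z _ h; simp at h
    | cons c p ih =>
      intro v z hp hv hz
      obtain rfl : c = v := by simpa using hv
      rcases List.mem_cons.1 hz with rfl | hz
      · exact .refl
      · rw [List.isChain_cons] at hp
        cases p with
        | nil => simp at hz
        | cons d p => exact .head (hp.1 d (by simp)) (ih hp.2 rfl hz)
  -- Traced back from `z`, the two chains coincide; neither can stop before the other, since
  -- vertices of `X` have no predecessor.
  have huniq : ∀ {x x' z : V}, x ∈ X → x' ∈ X → Relation.ReflTransGen r x z →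
      Relation.ReflTransGen r x' z → x = x' := by
    intro x x' z hx hx' h
    induction h with
    | refl =>
      intro h'
      cases h' with
      | refl => rfl
      | tail _ h => exact absurd hx (hX _ _ h)
    | tail _ hbc ih =>
      intro h'
      cases h' with
      | refl => exact absurd hx' (hX _ _ hbc)
      | tail h'' hbc' =>
        obtain rfl := hinj _ _ _ hbc hbc'
        exact ih h''
  choose p hp hhead hlast using fun x : X => hex _ x le_rfl (Or.inl x.2)
  refine ⟨fun k => p (X.equivFin.symm k), fun k => ⟨(hp _).imp fun a b => hadj a b, ?_,
    ⟨_, (X.equivFin.symm k).2, hhead _⟩, hlast _⟩, fun k l hkl => ?_⟩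
  · have hch : (p (X.equivFin.symm k)).IsChain fun a b => ht a < ht b :=
      (hp _).imp fun a b h => hht _ _ (hadj a b h)
    have : IsTrans V fun a b => ht a < ht b := ⟨fun a b c h h' => h.trans h'⟩
    exact (List.isChain_iff_pairwise.1 hch).imp fun h => by rintro rfl; exact lt_irrefl _ h
  · intro z hz hz'
    exact hkl (X.equivFin.symm.injective (Subtype.ext
      (huniq (X.equivFin.symm k).2 (X.equivFin.symm l).2 (hreach (hp _) (hhead _) hz)
        (hreach (hp _) (hhead _) hz'))))

end Paths

/-! ### Network matrices: independent columns give disjoint paths -/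

section Matrices

variable {V : Type*} [Fintype V] [DecidableEq V] {𝒢 : Digraph V} {K : Type*}

/-- `A` is the matrix of a network on `𝒢`: `A j i` vanishes unless `(i, j)` is an edge. -/
def IsNetworkMatrix [Zero K] (𝒢 : Digraph V) (A : Matrix V V K) : Prop :=
  ∀ i j, ¬ 𝒢.Adj i j → A j i = 0

/-- Each factor of `A` raises the height, so `A` is nilpotent. -/
theorem IsNetworkMatrix.isUnit_det [CommRing K] (hacyc : IsAcyclic 𝒢) {A : Matrix V V K}
    (hA : IsNetworkMatrix 𝒢 A) : IsUnit (1 - A).det := by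
  obtain ⟨ht, hht⟩ := hacyc.exists_height
  have hpow : ∀ n a b, ht a < ht b + n → (A ^ n) a b = 0 := by
    intro n
    induction n with
    | zero =>
      intro a b h
      rw [pow_zero, Matrix.one_apply_ne]
      rintro rfl
      omega
    | succ n ih =>
      intro a b h
      rw [pow_succ, Matrix.mul_apply]
      refine Finset.sum_eq_zero fun c _ => ?_
      by_cases hc : 𝒢.Adj b c
      · rw [ih a c (by have := hht _ _ hc; omega), zero_mul]
      · rw [hA b c hc, mul_zero]
  rw [← Matrix.isUnit_iff_isUnit_det]
  refine IsNilpotent.isUnit_one_sub ⟨(Finset.univ.sup ht) + 1, ?_⟩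
  ext a b
  refine hpow _ _ _ ?_
  have : ht a ≤ Finset.univ.sup ht := Finset.le_sup (Finset.mem_univ a)
  omega

/-- If the columns `X` of `(1 - A)⁻¹` restricted to the rows `Y` are linearly independent, then
there are `|X|` vertex-disjoint paths from `X` to `Y`. -/
theorem IsNetworkMatrix.hasDisjointPaths [Field K] (hacyc : IsAcyclic 𝒢) {A : Matrix V V K}
    (hA : IsNetworkMatrix 𝒢 A) {X Y : Finset V}
    (hinj : ∀ c : V → K, (∀ v ∉ X, c v = 0) → (∀ y ∈ Y, ((1 - A)⁻¹.mulVec c) y = 0) → c = 0) :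
    HasDisjointPaths 𝒢 X Y X.card := by
  classical
  have hu := hA.isUnit_det hacyc
  obtain ⟨ht, hht⟩ := hacyc.exists_height
  let t : {i // i ∉ Y} → Finset V := fun i =>
    Finset.univ.filter fun j => j ∉ X ∧ (1 - A) j i ≠ 0
  -- Hall's condition as a dimension count. If `v` is supported on `S` and `(1 - A) v` vanishes on
  -- `S.biUnion t`, then `c = (1 - A) v` is supported in `X`, while `(1 - A)⁻¹ c = v` vanishes on
  -- `Y`; hence `c = 0` and `v = 0`.
  have hall : ∀ S : Finset {i // i ∉ Y}, S.card ≤ (S.biUnion t).card := by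
    intro S
    let ext : (S → K) →ₗ[K] (V → K) :=
      { toFun := fun v i => if h : ∃ h' : i ∉ Y, (⟨i, h'⟩ : {i // i ∉ Y}) ∈ S then
          v ⟨⟨i, h.1⟩, h.2⟩ else 0
        map_add' := fun v w => by
          ext i
          by_cases h : ∃ h' : i ∉ Y, (⟨i, h'⟩ : {i // i ∉ Y}) ∈ S <;> simp [h]
        map_smul' := fun v w => by
          ext i
          by_cases h : ∃ h' : i ∉ Y, (⟨i, h'⟩ : {i // i ∉ Y}) ∈ S <;> simp [h] }
    let L : (S → K) →ₗ[K] (S.biUnion t → K) :=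
      (LinearMap.funLeft K K Subtype.val) ∘ₗ (Matrix.toLin' (1 - A)) ∘ₗ ext
    have hL : Function.Injective L := by
      rw [← LinearMap.ker_eq_bot, LinearMap.ker_eq_bot']
      intro v hv
      have hinv : (1 - A)⁻¹.mulVec ((1 - A).mulVec (ext v)) = ext v := by
        rw [Matrix.mulVec_mulVec, Matrix.nonsing_inv_mul _ hu, Matrix.one_mulVec]
      have h0 : (1 - A).mulVec (ext v) = 0 := by
        refine hinj _ (fun j hj => ?_) (fun y hy => ?_)
        · by_cases hjS : j ∈ S.biUnion t
          · exact congrFun hv ⟨j, hjS⟩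
          · refine Finset.sum_eq_zero fun i _ => ?_
            by_cases h : ∃ h' : i ∉ Y, (⟨i, h'⟩ : {i // i ∉ Y}) ∈ S
            · have : (1 - A) j i = 0 := by
                by_contra hne
                exact hjS (Finset.mem_biUnion.2 ⟨⟨i, h.1⟩, h.2,
                  (Finset.mem_filter_univ _).2 ⟨hj, hne⟩⟩)
              exact (congrArg (· * ext v i) this).trans (zero_mul _)
            · simp [ext, h]
        · rw [hinv]
          simp [ext, hy]
      rw [h0, Matrix.mulVec_zero] at hinv
      ext i
      have := congrFun hinv i.1.1
      simpa [ext, i.1.2] using this.symm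
    have h := LinearMap.finrank_le_finrank_of_injective hL
    rwa [Module.finrank_fintype_fun_eq_card, Module.finrank_fintype_fun_eq_card,
      Fintype.card_coe, Fintype.card_coe] at h
  obtain ⟨f, hf, hft⟩ := (Finset.all_card_le_biUnion_card_iff_exists_injective t).1 hall
  have hfX : ∀ i, f i ∉ X := fun i => by
    have := hft i
    simp only [t, Finset.mem_filter_univ] at this
    exact this.1
  have hfadj : ∀ i, f i ≠ i → 𝒢.Adj i (f i) := fun i hi => by
    by_contra h
    have := hft i
    simp only [t, Finset.mem_filter_univ] at this
    apply this.2
    rw [Matrix.sub_apply, Matrix.one_apply_ne hi, hA _ _ h, sub_zero]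
  -- Hall's injection from the complement of `Y` to that of `X` moves along an edge or fixes a
  -- vertex; iterating its moves from `X` traces the paths.
  refine hasDisjointPaths_of_relation hht (N := Finset.univ.sup ht)
    (fun v => Finset.le_sup (Finset.mem_univ v))
    (r := fun a b => ∃ h : a ∉ Y, f ⟨a, h⟩ = b ∧ b ≠ a) ?_ ?_ ?_ ?_
  · rintro a _ ⟨h, rfl, hne⟩
    exact hfadj ⟨a, h⟩ hne
  · rintro a a' _ ⟨h, rfl, hne⟩ ⟨h', he, hne'⟩
    exact congrArg Subtype.val (hf he).symm
  · rintro a _ ⟨h, rfl, hne⟩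
    exact hfX _
  · intro v hv
    by_cases hvY : v ∈ Y
    · exact Or.inl hvY
    refine Or.inr ⟨f ⟨v, hvY⟩, hvY, rfl, fun hfix => ?_⟩
    rcases hv with hv | ⟨a, h, hfa, hne⟩
    · exact hfX ⟨v, hvY⟩ (hfix.symm ▸ hv)
    · exact hne (congrArg Subtype.val (hf (hfix.trans hfa.symm)))

end Matrices

/-! ### Identification of a network matrix from part of its inverse -/

section Identification

theorem mem_inNbrs {V : Type*} [Fintype V] {𝒢 : Digraph V} {i j : V} :
    i ∈ inNbrs 𝒢 j ↔ 𝒢.Adj i j := by simp [inNbrs]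

theorem mem_outNbrs {V : Type*} [Fintype V] {𝒢 : Digraph V} {i j : V} :
    j ∈ outNbrs 𝒢 i ↔ 𝒢.Adj i j := by simp [outNbrs]

theorem linearMap_mulVec {V K : Type*} [Fintype V] [Field K] (φ : (V → K) →ₗ[K] K)
    (T : Matrix V V K) (c : V → K) :
    φ (T.mulVec c) = ∑ v, c v * φ (T.col v) := by
  rw [Matrix.mulVec_eq_sum, map_sum]
  refine Finset.sum_congr rfl fun v _ => ?_
  simp [Matrix.col_def]

variable {V : Type*} [Fintype V] [DecidableEq V] {𝒢 : Digraph V} {K : Type*} [Field K]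

theorem IsNetworkMatrix.inv_eq_one_add_mul (hacyc : IsAcyclic 𝒢) {A : Matrix V V K}
    (hA : IsNetworkMatrix 𝒢 A) : (1 - A)⁻¹ = 1 + A * (1 - A)⁻¹ := by
  have h := Matrix.mul_nonsing_inv _ (hA.isUnit_det hacyc)
  rw [sub_mul, one_mul] at h
  exact sub_eq_iff_eq_add.1 h

theorem IsNetworkMatrix.inv_eq_one_add_inv_mul (hacyc : IsAcyclic 𝒢) {A : Matrix V V K}
    (hA : IsNetworkMatrix 𝒢 A) : (1 - A)⁻¹ = 1 + (1 - A)⁻¹ * A := by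
  have h := Matrix.nonsing_inv_mul _ (hA.isUnit_det hacyc)
  rw [mul_sub, mul_one] at h
  exact sub_eq_iff_eq_add.1 h

/-- The columns `X` of `T`, restricted to the rows `Y`, are linearly independent. -/
def ColumnsIndep (T : Matrix V V K) (X Y : Finset V) : Prop :=
  ∀ c : V → K, (∀ v ∉ X, c v = 0) → (∀ y ∈ Y, T.mulVec c y = 0) → c = 0

/-- The rows `Y` of `T`, restricted to the columns `X`, are linearly independent. -/
def RowsIndep (T : Matrix V V K) (X Y : Finset V) : Prop :=
  ∀ a : V → K, (∀ v ∉ Y, a v = 0) → (∀ x ∈ X, Matrix.vecMul a T x = 0) → a = 0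

/-- This carries independence from the generic `θ₀` to every `θ₁` with the same measured transfer.
-/
theorem ColumnsIndep.congr {T T' : Matrix V V K} {X Y : Finset V} (h : ColumnsIndep T X Y)
    (he : ∀ y ∈ Y, ∀ x ∈ X, T' y x = T y x) : ColumnsIndep T' X Y := by
  refine fun c hc h0 => h c hc fun y hy => ?_
  rw [← h0 y hy]
  refine Finset.sum_congr rfl fun x _ => ?_
  by_cases hx : x ∈ X
  · exact congrArg (· * c x) (he y hy x hx).symm
  · simp [hc x hx]

/-- Independent columns have a dual functional that only sees the rows `Y`. -/
theorem ColumnsIndep.exists_dual {T : Matrix V V K} {X Y : Finset V} (h : ColumnsIndep T X Y)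
    {j : V} (hj : j ∈ X) : ∃ φ : (V → K) →ₗ[K] K, (∀ x, (∀ y ∈ Y, x y = 0) → φ x = 0) ∧
      ∀ r ∈ X, φ (T.col r) = if r = j then 1 else 0 := by
  let ρ : (V → K) →ₗ[K] (Y → K) := LinearMap.funLeft K K Subtype.val
  let M : (X → K) →ₗ[K] (Y → K) := Fintype.linearCombination K fun r : X => ρ (T.col r)
  have hM : LinearMap.ker M = ⊥ := by
    rw [LinearMap.ker_eq_bot']
    intro c hc
    have hz := h (fun v => if hv : v ∈ X then c ⟨v, hv⟩ else 0) (fun v hv => by simp [hv])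
      (fun y hy => by
        have h1 := congrFun hc ⟨y, hy⟩
        simp only [Matrix.mulVec, dotProduct]
        rw [← Finset.sum_subset (Finset.subset_univ X) (fun v _ hv => by simp [hv]),
          ← Finset.sum_coe_sort X]
        simpa [M, ρ, Fintype.linearCombination_apply, mul_comm, LinearMap.funLeft_apply] using h1)
    ext r
    simpa using congrFun hz r.1
  obtain ⟨g, hg⟩ := M.exists_leftInverse_of_injective hM
  refine ⟨LinearMap.proj ⟨j, hj⟩ ∘ₗ g ∘ₗ ρ, fun x hx => ?_, fun r hr => ?_⟩
  · have : ρ x = 0 := by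
      ext y
      exact hx y y.2
    simp [this]
  · have h1 : M (Pi.single ⟨r, hr⟩ 1) = ρ (T.col r) := by
      simp [M]
    have h2 := LinearMap.congr_fun hg (Pi.single ⟨r, hr⟩ 1)
    rw [LinearMap.comp_apply, h1] at h2
    rw [LinearMap.comp_apply, LinearMap.comp_apply, h2]
    simp [Pi.single_apply, eq_comm]

/-- The dual functional kills the columns whose exchange with `j` would enlarge the number of
disjoint paths. -/
theorem IsNetworkMatrix.dual_col_eq_zero (hacyc : IsAcyclic 𝒢) {A : Matrix V V K}
    (hA : IsNetworkMatrix 𝒢 A) {X Y S : Finset V} {j s : V} (hj : j ∈ X)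
    (hind : ColumnsIndep (1 - A)⁻¹ X Y)
    (hS : maxDisjointPaths 𝒢 ((X ∪ S) \ {j}) Y < X.card)
    {φ : (V → K) →ₗ[K] K} (hφ : ∀ x, (∀ y ∈ Y, x y = 0) → φ x = 0)
    (hφX : ∀ r ∈ X, φ ((1 - A)⁻¹.col r) = if r = j then 1 else 0)
    (hs : s ∈ S) (hsj : s ≠ j) : φ ((1 - A)⁻¹.col s) = 0 := by
  by_cases hsX : s ∈ X
  · rw [hφX s hsX, if_neg hsj]
  by_contra hne
  -- If `φ` is nonzero on column `s`, applying it to a relation among the exchanged columns isolates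
  -- the coefficient of `s`; the rest is a relation among the columns `X`.
  have hpaths := hA.hasDisjointPaths hacyc (X := insert s (X.erase j)) (Y := Y) (by
    intro c hc hTc
    refine hind c (fun v hv => ?_) hTc
    by_cases hvs : v = s
    · subst hvs
      have h := hφ _ hTc
      rw [linearMap_mulVec, Finset.sum_eq_single v] at h
      · exact (mul_eq_zero.1 h).resolve_right hne
      · intro u _ huv
        by_cases huX : u ∈ X.erase j
        · rw [hφX u (Finset.mem_of_mem_erase huX), if_neg (Finset.ne_of_mem_erase huX), mul_zero]
        · rw [hc u (by simp only [Finset.mem_insert, huv, huX, or_self, not_false_eq_true]),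
            zero_mul]
      · simp
    · exact hc v fun h => (Finset.mem_insert.1 h).elim hvs fun h => hv (Finset.mem_of_mem_erase h))
  rw [Finset.card_insert_of_notMem (fun h => hsX (Finset.mem_of_mem_erase h)),
    Finset.card_erase_add_one hj] at hpaths
  refine absurd (le_maxDisjointPaths (hpaths.mono ?_ subset_rfl)) (not_le.2 hS)
  intro v hv
  rw [Finset.mem_insert, Finset.mem_erase] at hv
  simp only [Finset.mem_sdiff, Finset.mem_union, Finset.mem_singleton]
  rcases hv with rfl | ⟨h1, h2⟩
  · exact ⟨Or.inr hs, hsj⟩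
  · exact ⟨Or.inl h2, h1⟩

/-- Column `i` of `T = 1 + T A` is `e_i` plus the columns of the out-neighbours `k` of `i`, weighted
by `A k i`; only `k = j` survives `φ`. -/
theorem IsNetworkMatrix.apply_eq_dual (hacyc : IsAcyclic 𝒢) {A : Matrix V V K}
    (hA : IsNetworkMatrix 𝒢 A) {i j : V} {φ : (V → K) →ₗ[K] K}
    (hφj : φ ((1 - A)⁻¹.col j) = 1)
    (hφ : ∀ k, 𝒢.Adj i k → k ≠ j → φ ((1 - A)⁻¹.col k) = 0) :
    A j i = φ ((1 - A)⁻¹.col i) - φ (Pi.single i 1) := by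
  have h : (1 - A)⁻¹.col i = Pi.single i 1 + (1 - A)⁻¹.mulVec (A.col i) := by
    conv_lhs => rw [hA.inv_eq_one_add_inv_mul hacyc]
    ext v
    simp [Matrix.add_apply, Matrix.one_apply, Pi.single_apply, Matrix.mul_apply, Matrix.mulVec,
      dotProduct]
  rw [h, map_add, add_sub_cancel_left, linearMap_mulVec, Finset.sum_eq_single j]
  · simp [hφj]
  · intro k _ hk
    by_cases hik : 𝒢.Adj i k
    · rw [hφ k hik hk, mul_zero]
    · simp [hA i k hik]
  · simp

/-- One functional serves both matrices: it sees only the rows `Y`, where the columns `R` of the two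
inverses agree. -/
theorem row_eq_of_unmeasured (hacyc : IsAcyclic 𝒢) {A B : Matrix V V K}
    (hA : IsNetworkMatrix 𝒢 A) (hB : IsNetworkMatrix 𝒢 B) {R X Y : Finset V} {j : V}
    (hX : X ⊆ R) (hj : j ∈ X)
    (hT : ∀ y ∈ Y, ∀ r ∈ R, (1 - B)⁻¹ y r = (1 - A)⁻¹ y r)
    (hind : ColumnsIndep (1 - A)⁻¹ X Y)
    (hS : maxDisjointPaths 𝒢 ((X ∪ auxSet 𝒢 R j) \ {j}) Y < X.card) (i : V) :
    B j i = A j i := by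
  by_cases hij : 𝒢.Adj i j
  swap
  · rw [hA i j hij, hB i j hij]
  have hne : i ≠ j := by
    rintro rfl
    exact hacyc _ (.single hij)
  obtain ⟨φ, hφ, hφX⟩ := hind.exists_dual hj
  have hcongr : ∀ r ∈ R, φ ((1 - B)⁻¹.col r) = φ ((1 - A)⁻¹.col r) := fun r hr => by
    rw [← sub_eq_zero, ← map_sub]
    exact hφ _ fun y hy => sub_eq_zero.2 (hT y hy r hr)
  have hφX' : ∀ r ∈ X, φ ((1 - B)⁻¹.col r) = if r = j then 1 else 0 := fun r hr =>
    (hcongr r (hX hr)).trans (hφX r hr)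
  have hindB : ColumnsIndep (1 - B)⁻¹ X Y := hind.congr fun y hy x hx => hT y hy x (hX hx)
  have hA0 : ∀ s ∈ auxSet 𝒢 R j, s ≠ j → φ ((1 - A)⁻¹.col s) = 0 := fun s hs hsj =>
    hA.dual_col_eq_zero hacyc hj hind hS hφ hφX hs hsj
  have hB0 : ∀ s ∈ auxSet 𝒢 R j, s ≠ j → φ ((1 - B)⁻¹.col s) = 0 := fun s hs hsj =>
    hB.dual_col_eq_zero hacyc hj hindB hS hφ hφX' hs hsj
  have hout : ∀ k, 𝒢.Adj i k → k ∈ auxSet 𝒢 R j := fun k hk =>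
    Finset.mem_union_right _ (Finset.mem_biUnion.2 ⟨i, mem_inNbrs.2 hij, mem_outNbrs.2 hk⟩)
  rw [hA.apply_eq_dual hacyc (by simp [hφX j hj]) fun k hk => hA0 k (hout k hk),
    hB.apply_eq_dual hacyc (by simp [hφX' j hj]) fun k hk => hB0 k (hout k hk)]
  by_cases hiR : i ∈ R
  · rw [hcongr i hiR]
  · have hi : i ∈ auxSet 𝒢 R j :=
      Finset.mem_union_left _ (Finset.mem_sdiff.2 ⟨mem_inNbrs.2 hij, hiR⟩)
    rw [hA0 i hi hne, hB0 i hi hne]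

theorem eq_of_inv_eq (hacyc : IsAcyclic 𝒢) {A B : Matrix V V K}
    (hA : IsNetworkMatrix 𝒢 A) (hB : IsNetworkMatrix 𝒢 B) {R C : Finset V}
    (hT : ∀ y ∈ C, ∀ r ∈ R, (1 - B)⁻¹ y r = (1 - A)⁻¹ y r)
    (hC : ∀ j ∈ C, RowsIndep (1 - A)⁻¹ R (inNbrs 𝒢 j))
    (hun : ∀ j ∉ C, ∃ Y ⊆ C, ∃ X ⊆ R, j ∈ X ∧ ColumnsIndep (1 - A)⁻¹ X Y ∧
      maxDisjointPaths 𝒢 ((X ∪ auxSet 𝒢 R j) \ {j}) Y < X.card) : B = A := by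
  obtain ⟨ht, hht⟩ := hacyc.exists_height
  have hrow : ∀ {D : Matrix V V K}, IsNetworkMatrix 𝒢 D → ∀ j r,
      (1 - D)⁻¹ j r = (1 : Matrix V V K) j r + ∑ i, D j i * (1 - D)⁻¹ i r := fun hD j r => by
    conv_lhs => rw [hD.inv_eq_one_add_mul hacyc]
    rw [Matrix.add_apply, Matrix.mul_apply]
  have hmain : ∀ n j, ht j < n → (∀ i, B j i = A j i) ∧
      ∀ r ∈ R, (1 - B)⁻¹ j r = (1 - A)⁻¹ j r := by
    intro n
    induction n with
    | zero => intro j h; exact absurd h (Nat.not_lt_zero _)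
    | succ n ih =>
      intro j hj
      have hpred : ∀ r ∈ R, ∀ i, B j i * (1 - B)⁻¹ i r = B j i * (1 - A)⁻¹ i r := by
        intro r hr i
        by_cases hij : 𝒢.Adj i j
        · rw [(ih i (by have := hht _ _ hij; omega)).2 r hr]
        · rw [hB i j hij, zero_mul, zero_mul]
      by_cases hjC : j ∈ C
      · refine ⟨?_, hT j hjC⟩
        -- By induction the difference of the two rows is a linear relation among the in-neighbour
        -- rows of `(1 - A)⁻¹` over `R`.
        have h := hC j hjC (fun i => B j i - A j i) (fun i hi => by
          have hij : ¬ 𝒢.Adj i j := fun h => hi (mem_inNbrs.2 h)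
          rw [hA i j hij, hB i j hij, sub_zero]) (fun r hr => by
          have h1 := hT j hjC r hr
          rw [hrow hA, hrow hB, Finset.sum_congr rfl fun i _ => hpred r hr i] at h1
          have h2 := add_left_cancel h1
          simp only [Matrix.vecMul, dotProduct, sub_mul, Finset.sum_sub_distrib]
          exact sub_eq_zero.2 h2)
        exact fun i => sub_eq_zero.1 (congrFun h i)
      · obtain ⟨Y, hY, X, hX, hjX, hind, hS⟩ := hun j hjC
        -- Row `j` needs no induction here; the induction recovers the unmeasured transfer to `j`,
        -- which later vertices use.
        have hBA := row_eq_of_unmeasured hacyc hA hB hX hjX (fun y hy => hT y (hY hy)) hind hS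
        refine ⟨hBA, fun r hr => ?_⟩
        rw [hrow hA, hrow hB, Finset.sum_congr rfl fun i _ => hpred r hr i]
        simp only [hBA]
  ext j i
  exact (hmain _ j (Nat.lt_succ_self _)).1 i

end Identification

/-! ### Minors of the inverse as functions of the edge weights -/

section Generic

open Classical in
/-- The network matrix with the given edge weights. -/
noncomputable def netMatrix {V K : Type*} [Zero K] (𝒢 : Digraph V) (w : Edge 𝒢 → K) :
    Matrix V V K :=
  fun j i => if h : 𝒢.Adj i j then w ⟨(i, j), h⟩ else 0

theorem isNetworkMatrix_netMatrix {V K : Type*} [Zero K] (𝒢 : Digraph V) (w : Edge 𝒢 → K) :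
    IsNetworkMatrix 𝒢 (netMatrix 𝒢 w) := fun i j h => by simp [netMatrix, h]

variable {V : Type*} [Fintype V] [DecidableEq V] {K : Type*} [Field K]

theorem ColumnsIndep.of_det_ne_zero {T : Matrix V V K} {X Y : Finset V} {n : ℕ} {x y : Fin n → V}
    (hx : ∀ k, x k ∈ X) (hy : ∀ k, y k ∈ Y) (hxi : Function.Injective x) (hn : X.card = n)
    (hdet : (T.submatrix y x).det ≠ 0) : ColumnsIndep T X Y := by
  have himg : Finset.univ.image x = X := by
    refine Finset.eq_of_subset_of_card_le (fun v hv => ?_) ?_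
    · obtain ⟨k, -, rfl⟩ := Finset.mem_image.1 hv
      exact hx k
    · rw [Finset.card_image_of_injective _ hxi, Finset.card_univ, Fintype.card_fin, hn]
  intro c hc hTc
  have h0 : c ∘ x = 0 := by
    refine Matrix.eq_zero_of_mulVec_eq_zero hdet (funext fun k => ?_)
    rw [Pi.zero_apply, ← hTc (y k) (hy k)]
    simp only [Matrix.mulVec, dotProduct]
    rw [← Finset.sum_subset (Finset.subset_univ X) (fun v _ hv => by simp [hc v hv]), ← himg,
      Finset.sum_image fun _ _ _ _ h => hxi h]
    rfl
  ext v
  by_cases hv : v ∈ X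
  · rw [← himg] at hv
    obtain ⟨k, -, rfl⟩ := Finset.mem_image.1 hv
    exact congrFun h0 k
  · exact hc v hv

theorem RowsIndep.of_det_ne_zero {T : Matrix V V K} {X Y : Finset V} {n : ℕ} {x y : Fin n → V}
    (hx : ∀ k, x k ∈ X) (hy : ∀ k, y k ∈ Y) (hyi : Function.Injective y) (hn : Y.card = n)
    (hdet : (T.submatrix y x).det ≠ 0) : RowsIndep T X Y := by
  have h : ColumnsIndep T.transpose Y X := .of_det_ne_zero hy hx hyi hn (by
    rwa [← Matrix.transpose_submatrix, Matrix.det_transpose])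
  exact fun a ha h0 => h a ha fun r hr => by rw [Matrix.mulVec_transpose]; exact h0 r hr

/-- The determinant of the bordered matrix is, up to sign and the factor `det (1 - A)`, the minor of
`(1 - A)⁻¹` with rows `y` and columns `x`; it is affine in each entry of `A`. -/
def bordered {n : ℕ} (A : Matrix V V K) (x y : Fin n → V) : Matrix (V ⊕ Fin n) (V ⊕ Fin n) K :=
  Matrix.fromBlocks (1 - A) ((1 : Matrix V V K).submatrix id x)
    ((1 : Matrix V V K).submatrix y id) 0

/-- The Schur complement of `1 - A` is minus the submatrix. -/
theorem det_bordered_ne_zero_iff {n : ℕ} {A : Matrix V V K} (hA : IsUnit (1 - A).det)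
    (x y : Fin n → V) :
    (bordered A x y).det ≠ 0 ↔ ((1 - A)⁻¹.submatrix y x).det ≠ 0 := by
  have := Matrix.invertibleOfIsUnitDet _ hA
  have h : (1 : Matrix V V K).submatrix y id * (1 - A)⁻¹ * (1 : Matrix V V K).submatrix id x =
      (1 - A)⁻¹.submatrix y x := by
    ext k l
    simp [Matrix.mul_apply, Matrix.one_apply]
  rw [bordered, Matrix.det_fromBlocks₁₁, Matrix.invOf_eq_nonsing_inv, h, zero_sub,
    Matrix.det_neg, mul_ne_zero_iff, mul_ne_zero_iff]
  simp [hA.ne_zero]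

variable {𝒢 : Digraph V}

/-- The weight of `e` enters a single entry, and the determinant is linear in the row of that entry.
-/
theorem det_bordered_affine {n : ℕ} [DecidableEq (Edge 𝒢)] (x y : Fin n → V) (w : Edge 𝒢 → K)
    (e : Edge 𝒢) : ∃ α β : K, ∀ t,
      (bordered (netMatrix 𝒢 (Function.update w e t)) x y).det = α + t * β := by
  set B := bordered (netMatrix 𝒢 w) x y
  have h : ∀ t, bordered (netMatrix 𝒢 (Function.update w e t)) x y =
      B.updateRow (Sum.inl e.1.2) (bordered (netMatrix 𝒢 (Function.update w e 0)) x y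
        (Sum.inl e.1.2) + t • Pi.single (Sum.inl e.1.1) (-1)) := by
    intro t
    obtain ⟨⟨i, j⟩, hij⟩ := e
    ext a b
    rcases a with a | a
    · by_cases ha : a = j
      · subst ha
        rw [Matrix.updateRow_self]
        rcases b with b | b
        · by_cases hb : b = i
          · subst hb
            simp [bordered, netMatrix, hij, sub_eq_add_neg]
          · have hne : ∀ h : 𝒢.Adj b a, (⟨(b, a), h⟩ : Edge 𝒢) ≠ ⟨(i, a), hij⟩ := fun h h' =>
              hb (congrArg (fun z => z.1.1) h')
            simp [bordered, netMatrix, hb, hne]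
        · simp [bordered]
      · rw [Matrix.updateRow_ne (by simpa using ha)]
        rcases b with b | b
        · have hne : ∀ h : 𝒢.Adj b a, (⟨(b, a), h⟩ : Edge 𝒢) ≠ ⟨(i, j), hij⟩ := fun h h' =>
            ha (congrArg (fun z => z.1.2) h')
          simp [B, bordered, netMatrix, hne]
        · simp [B, bordered]
    · rw [Matrix.updateRow_ne (by simp)]
      rcases b with b | b <;> simp [B, bordered]
  refine ⟨(B.updateRow (Sum.inl e.1.2) (bordered (netMatrix 𝒢 (Function.update w e 0)) x y
    (Sum.inl e.1.2))).det, (B.updateRow (Sum.inl e.1.2) (Pi.single (Sum.inl e.1.1) (-1))).det,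
    fun t => ?_⟩
  rw [h, Matrix.det_updateRow_add, Matrix.det_updateRow_smul]

/-- A function that is affine in each variable and does not vanish identically does not vanish on
a grid with two points in each direction. -/
theorem exists_ne_zero_of_affine {ι : Type*} [Finite ι] [DecidableEq ι] {F : (ι → K) → K}
    (hF : ∀ w e, ∃ α β : K, ∀ t, F (Function.update w e t) = α + t * β)
    {w₀ : ι → K} (h₀ : F w₀ ≠ 0) {a b : ι → K} (hab : ∀ e, a e ≠ b e) :
    ∃ w, (∀ e, w e = a e ∨ w e = b e) ∧ F w ≠ 0 := by
  have := Fintype.ofFinite ι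
  suffices h : ∀ S : Finset ι, ∃ w, (∀ e ∈ S, w e = a e ∨ w e = b e) ∧ F w ≠ 0 by
    simpa using h Finset.univ
  intro S
  induction S using Finset.induction_on with
  | empty => exact ⟨w₀, by simp, h₀⟩
  | insert e S he ih =>
    obtain ⟨w, hw, hFw⟩ := ih
    obtain ⟨α, β, hαβ⟩ := hF w e
    -- An affine function with two distinct zeros vanishes identically, in particular at the current
    -- value `w e`.
    have hex : ∃ t, (t = a e ∨ t = b e) ∧ F (Function.update w e t) ≠ 0 := by
      by_contra! hcon
      have h1 := hcon (a e) (Or.inl rfl)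
      have h2 := hcon (b e) (Or.inr rfl)
      rw [hαβ] at h1 h2
      have hβ : β = 0 := by
        have : (a e - b e) * β = 0 := by linear_combination h1 - h2
        exact (mul_eq_zero.1 this).resolve_left (sub_ne_zero.2 (hab e))
      have h3 := hαβ (w e)
      rw [Function.update_eq_self] at h3
      apply hFw
      rw [h3, hβ]
      simpa [hβ] using h1
    obtain ⟨t, ht, hFt⟩ := hex
    refine ⟨_, fun e' he' => ?_, hFt⟩
    by_cases hee : e' = e
    · subst hee
      simpa using ht
    · rw [Function.update_of_ne hee]
      exact hw e' ((Finset.mem_insert.1 he').resolve_left hee)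

/-- For a system of disjoint paths, the corresponding minor of `(1 - A)⁻¹` is nonzero if `A` has
weight one on the edges of the system and zero elsewhere. -/
theorem HasDisjointPaths.exists_det_ne_zero (K : Type*) [Field K] (hacyc : IsAcyclic 𝒢)
    {X Y : Finset V} {n : ℕ}
    (h : HasDisjointPaths 𝒢 X Y n) : ∃ x y : Fin n → V, Function.Injective x ∧
      Function.Injective y ∧ (∀ k, x k ∈ X) ∧ (∀ k, y k ∈ Y) ∧ ∃ w : Edge 𝒢 → K,
        ((1 - netMatrix 𝒢 w)⁻¹.submatrix y x).det ≠ 0 := by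
  classical
  obtain ⟨p, hp, hd⟩ := h
  choose hchain hnodup hstart hend using hp
  choose x hx hhead using hstart
  choose y hy hlast using hend
  have hsame : ∀ {k l v}, v ∈ p k → v ∈ p l → k = l := fun {k l v} hk hl => by
    by_contra hne
    exact hd hne hk hl
  have hxmem : ∀ k, x k ∈ p k := fun k => List.mem_of_mem_head? (hhead k)
  have hymem : ∀ k, y k ∈ p k := fun k => List.mem_of_mem_getLast? (hlast k)
  refine ⟨x, y, fun k l hkl => hsame (hxmem k) (hkl ▸ hxmem l),
    fun k l hkl => hsame (hymem k) (hkl ▸ hymem l), hx, hy,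
    fun e => if ∃ k m, (p k)[m]? = some e.1.1 ∧ (p k)[m + 1]? = some e.1.2 then 1 else 0, ?_⟩
  set A : Matrix V V K := netMatrix 𝒢 _ with hA
  have hu : IsUnit (1 - A).det := (isNetworkMatrix_netMatrix 𝒢 _).isUnit_det hacyc
  have hAapp : ∀ j i, A j i = if ∃ k m, (p k)[m]? = some i ∧ (p k)[m + 1]? = some j
      then 1 else 0 := by
    intro j i
    by_cases hij : 𝒢.Adj i j
    · simp [hA, netMatrix, hij]
    · rw [if_neg]
      · simp [hA, netMatrix, hij]
      · rintro ⟨k, m, h1, h2⟩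
        obtain ⟨hm, rfl⟩ := List.getElem?_eq_some_iff.1 h2
        obtain ⟨hm', rfl⟩ := List.getElem?_eq_some_iff.1 h1
        exact hij (List.isChain_iff_getElem.1 (hchain k) m hm)
  -- Column `x l` of the inverse is the indicator of path `l`: each later vertex of the path
  -- receives exactly 1, from its predecessor. By disjointness `y k` lies on path `l` only if `k =
  -- l`.
  have hcol : ∀ l, (1 - A).mulVec (fun v => if v ∈ p l then 1 else 0) = Pi.single (x l) 1 := by
    intro l
    ext j
    rw [Matrix.sub_mulVec, Matrix.one_mulVec, Pi.sub_apply]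
    simp only [Matrix.mulVec, dotProduct]
    by_cases hj : j ∈ p l
    · obtain ⟨m, hm, hmj⟩ := List.mem_iff_getElem.1 hj
      cases m with
      | zero =>
        have hxj : x l = j := by
          have := hhead l
          rw [List.head?_eq_getElem?, List.getElem?_eq_getElem hm, hmj] at this
          exact (Option.some.inj this).symm
        rw [if_pos hj, hxj, Pi.single_eq_same, Finset.sum_eq_zero, sub_zero]
        intro i _
        rw [hAapp, if_neg, zero_mul]
        rintro ⟨k, m, -, h2⟩
        obtain rfl := hsame hj (List.mem_of_getElem? h2)
        obtain ⟨hm', h3⟩ := List.getElem?_eq_some_iff.1 h2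
        have := (hnodup l).getElem_inj_iff.1 (h3.trans hmj.symm)
        omega
      | succ m =>
        have hxj : j ≠ x l := by
          intro hxj
          have := hhead l
          rw [List.head?_eq_getElem?] at this
          obtain ⟨hm', h3⟩ := List.getElem?_eq_some_iff.1 this
          have := (hnodup l).getElem_inj_iff.1 (h3.trans (hxj.symm.trans hmj.symm))
          omega
        rw [if_pos hj, Pi.single_eq_of_ne hxj, sub_eq_zero,
          Finset.sum_eq_single ((p l)[m]'(by omega))]
        · rw [hAapp, if_pos ⟨l, m, List.getElem?_eq_getElem _, by
            rw [List.getElem?_eq_getElem hm, hmj]⟩, if_pos (List.getElem_mem _), mul_one]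
        · intro i _ hi
          rw [hAapp, if_neg, zero_mul]
          rintro ⟨k, m', h1, h2⟩
          obtain rfl := hsame hj (List.mem_of_getElem? h2)
          obtain ⟨hm', h3⟩ := List.getElem?_eq_some_iff.1 h2
          obtain ⟨hm'', h4⟩ := List.getElem?_eq_some_iff.1 h1
          have := (hnodup l).getElem_inj_iff.1 (h3.trans hmj.symm)
          obtain rfl : m' = m := by omega
          exact hi h4.symm
        · simp
    · rw [if_neg hj, Pi.single_eq_of_ne (by rintro rfl; exact hj (hxmem l)),
        Finset.sum_eq_zero, sub_zero]
      intro i _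
      by_cases hi : i ∈ p l
      · rw [hAapp, if_neg, zero_mul]
        rintro ⟨k, m, h1, h2⟩
        obtain rfl := hsame hi (List.mem_of_getElem? h1)
        exact hj (List.mem_of_getElem? h2)
      · rw [if_neg hi, mul_zero]
  have hone : (1 - A)⁻¹.submatrix y x = 1 := by
    ext k l
    have h1 := congrArg ((1 - A)⁻¹.mulVec) (hcol l)
    rw [Matrix.mulVec_mulVec, Matrix.nonsing_inv_mul _ hu, Matrix.one_mulVec] at h1
    have h2 := congrFun h1 (y k)
    rw [Matrix.mulVec_single_one] at h2
    rw [Matrix.submatrix_apply, Matrix.one_apply]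
    refine h2.symm.trans (if_congr ⟨fun h => hsame (hymem k) h, ?_⟩ rfl rfl)
    rintro rfl
    exact hymem k
  rw [hone, Matrix.det_one]
  exact one_ne_zero

end Generic

open MeasureTheory Filter Topology

/-! ### Rational functions with analytic coefficients -/

section AnalyticCoefficients

variable {E : Type*} [NormedAddCommGroup E] [NormedSpace ℝ E]

/-- The polynomial-valued functions whose coefficients are analytic on `U`. -/
def analyticPolynomials (U : Set E) : Subring (E → ℝ[X]) where
  carrier := {f | ∀ m, AnalyticOnNhd ℝ (fun θ => (f θ).coeff m) U}
  zero_mem' m := by simpa using analyticOnNhd_const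
  one_mem' m := analyticOnNhd_const
  add_mem' {f g} hf hg m := by
    have h : (fun θ => ((f + g) θ).coeff m) =
        (fun θ => (f θ).coeff m) + fun θ => (g θ).coeff m := by
      ext θ
      simp
    rw [h]
    exact (hf m).add (hg m)
  neg_mem' {f} hf m := by
    have h : (fun θ => ((-f) θ).coeff m) = -fun θ => (f θ).coeff m := by
      ext θ
      simp
    rw [h]
    exact (hf m).neg
  mul_mem' hf hg m := by
    simp only [Pi.mul_apply, Polynomial.coeff_mul]
    exact Finset.analyticOnNhd_fun_sum _ fun i _ => (hf i.1).mul (hg i.2)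

/-- The functions with values in `ℝ(q)` that become polynomials with analytic coefficients
after multiplication by a power of `d`. -/
def analyticFractions (U : Set E) (d : E → ℝ[X]) (hd : d ∈ analyticPolynomials U) :
    Subring (E → RatFunc ℝ) where
  carrier := {f | ∃ N ∈ analyticPolynomials U, ∃ k : ℕ, ∀ θ, d θ ≠ 0 →
    algebraMap ℝ[X] (RatFunc ℝ) (d θ) ^ k * f θ = algebraMap ℝ[X] (RatFunc ℝ) (N θ)}
  zero_mem' := ⟨0, zero_mem _, 0, by simp⟩
  one_mem' := ⟨1, one_mem _, 0, by simp⟩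
  add_mem' := by
    rintro f g ⟨N, hN, k, h⟩ ⟨N', hN', k', h'⟩
    refine ⟨d ^ k' * N + d ^ k * N',
      add_mem (mul_mem (pow_mem hd _) hN) (mul_mem (pow_mem hd _) hN'), k + k', fun θ hθ => ?_⟩
    simp only [Pi.add_apply, Pi.mul_apply, Pi.pow_apply, map_add, map_mul, map_pow, ← h θ hθ,
      ← h' θ hθ]
    ring
  neg_mem' := by
    rintro f ⟨N, hN, k, h⟩
    exact ⟨-N, neg_mem hN, k, fun θ hθ => by simp [← h θ hθ]⟩
  mul_mem' := by
    rintro f g ⟨N, hN, k, h⟩ ⟨N', hN', k', h'⟩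
    refine ⟨N * N', mul_mem hN hN', k + k', fun θ hθ => ?_⟩
    simp only [Pi.mul_apply, map_mul, ← h θ hθ, ← h' θ hθ]
    ring

theorem det_mem_subring {ι α R : Type*} [Fintype ι] [DecidableEq ι] [CommRing R]
    (S : Subring (α → R)) (B : α → Matrix ι ι R) (hB : ∀ a b, (fun θ => B θ a b) ∈ S) :
    (fun θ => (B θ).det) ∈ S := by
  have h : (fun θ => (B θ).det) = ∑ σ : Equiv.Perm ι, Equiv.Perm.sign σ •
      ∏ i, fun θ => B θ (σ i) i := by
    ext θ
    simp [Matrix.det_apply]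
  rw [h]
  refine sum_mem fun σ _ => ?_
  rw [Units.smul_def]
  exact zsmul_mem (prod_mem fun i _ => hB _ _) _

theorem ae_ne_zero_of_mem_analyticPolynomials [FiniteDimensional ℝ E] [MeasurableSpace E]
    [BorelSpace E] (μ : Measure E) [μ.IsAddHaarMeasure] {U : Set E} (hU : IsOpen U)
    (hc : IsPreconnected U) {N : E → ℝ[X]} (hN : N ∈ analyticPolynomials U) {y : E} (hy : y ∈ U)
    (hNy : N y ≠ 0) : ∀ᵐ θ ∂μ, θ ∈ U → N θ ≠ 0 := by
  obtain ⟨m, hm⟩ : ∃ m, (N y).coeff m ≠ 0 := by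
    by_contra! h
    exact hNy (Polynomial.ext h)
  filter_upwards [(hN m).ae_ne_zero μ hU hc hy hm] with θ hθ hθU h0
  exact hθ hθU (by rw [h0, Polynomial.coeff_zero])

/-- Where `d` is nonzero, clearing denominators turns a zero of `f` into a zero of an analytic
polynomial. -/
theorem ae_ne_zero_of_mem_analyticFractions [FiniteDimensional ℝ E] [MeasurableSpace E]
    [BorelSpace E] (μ : Measure E) [μ.IsAddHaarMeasure] {U : Set E} (hU : IsOpen U)
    (hc : IsPreconnected U) {d : E → ℝ[X]} (hd : d ∈ analyticPolynomials U)
    {f : E → RatFunc ℝ} (hf : f ∈ analyticFractions U d hd) {y : E} (hy : y ∈ U)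
    (hdy : d y ≠ 0) (hfy : f y ≠ 0) : ∀ᵐ θ ∂μ, θ ∈ U → d θ ≠ 0 → f θ ≠ 0 := by
  obtain ⟨N, hN, k, h⟩ := hf
  have hinj := IsFractionRing.injective ℝ[X] (RatFunc ℝ)
  have hNy : N y ≠ 0 := by
    intro h0
    have := h y hdy
    rw [h0, map_zero, mul_eq_zero] at this
    exact this.elim (pow_ne_zero _ ((map_ne_zero_iff _ hinj).2 hdy)) hfy
  filter_upwards [ae_ne_zero_of_mem_analyticPolynomials μ hU hc hN hy hNy] with θ hθ hθU hdθ h0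
  have := h θ hdθ
  rw [h0, mul_zero, eq_comm, map_eq_zero_iff _ hinj] at this
  exact hθ hθU this

end AnalyticCoefficients

/-! ### Generic rank in a model set -/

section ModelSets

variable {V : Type*} {𝒢 : Digraph V} (M : ModelSet 𝒢)

theorem ModelSet.isNetworkMatrix_G (θ : Fin M.p → ℝ) : IsNetworkMatrix 𝒢 (M.G θ) :=
  isNetworkMatrix_netMatrix 𝒢 fun e => M.module e θ

/-- Near any parameter with nonzero denominators, each module takes a second value. -/
theorem ModelSet.exists_module_ne (e : Edge 𝒢) {θ₀ : Fin M.p → ℝ} (hθ₀ : θ₀ ∈ M.U)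
    (hden : M.den e θ₀ ≠ 0) {W : Set (Fin M.p → ℝ)} (hW : W ∈ 𝓝 θ₀)
    (hWden : ∀ θ ∈ W, M.den e θ ≠ 0) : ∃ θ ∈ W, M.module e θ₀ ≠ M.module e θ := by
  by_contra! hcon
  have hinj := IsFractionRing.injective ℝ[X] (RatFunc ℝ)
  have hmem : (fun θ => M.num e θ₀ * M.den e θ - M.num e θ * M.den e θ₀) ∈
      analyticPolynomials M.U := by
    have hconst : ∀ P : ℝ[X], (fun _ => P) ∈ analyticPolynomials M.U :=
      fun P m => analyticOnNhd_const
    exact sub_mem (mul_mem (hconst _) (M.analytic_den e)) (mul_mem (M.analytic_num e) (hconst _))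
  -- Local constancy, in cross-multiplied form, spreads over `U` by the identity theorem and
  -- contradicts `nonconstant`.
  have hzero : ∀ θ ∈ M.U, M.num e θ₀ * M.den e θ = M.num e θ * M.den e θ₀ := by
    intro θ hθ
    rw [← sub_eq_zero]
    ext m
    refine (hmem m).eqOn_zero_of_preconnected_of_eventuallyEq_zero M.isPreconnected_U hθ₀ ?_ hθ
    filter_upwards [hW] with θ' hθ'
    have h := hcon θ' hθ'
    rw [ModelSet.module, ModelSet.module, div_eq_div_iff ((map_ne_zero_iff _ hinj).2 hden)
      ((map_ne_zero_iff _ hinj).2 (hWden θ' hθ')), ← map_mul, ← map_mul] at h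
    simp [hinj h]
  obtain ⟨θ, hθ, θ', hθ', hne⟩ := M.nonconstant e
  apply hne
  have h1 := hzero θ (M.Θ_subset hθ)
  have h2 := hzero θ' (M.Θ_subset hθ')
  refine mul_right_cancel₀ hden ?_
  linear_combination M.den e θ * h2 - M.den e θ' * h1

variable [Fintype V]

open Classical in
/-- The product of all the denominators. -/
noncomputable def ModelSet.denProd (θ : Fin M.p → ℝ) : ℝ[X] := ∏ e, M.den e θ

theorem ModelSet.denProd_mem : M.denProd ∈ analyticPolynomials M.U := by
  classical
  have h : M.denProd = ∏ e, M.den e := by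
    ext1 θ
    simp [ModelSet.denProd]
  rw [h]
  exact prod_mem fun e _ => M.analytic_den e

theorem ModelSet.denProd_ne_zero_iff (θ : Fin M.p → ℝ) :
    M.denProd θ ≠ 0 ↔ ∀ e, M.den e θ ≠ 0 := by
  simp [ModelSet.denProd, Finset.prod_ne_zero_iff]

theorem ModelSet.module_mem (e : Edge 𝒢) :
    M.module e ∈ analyticFractions M.U M.denProd M.denProd_mem := by
  classical
  refine ⟨M.num e * ∏ e' ∈ Finset.univ.erase e, M.den e',
    mul_mem (M.analytic_num e) (prod_mem fun e' _ => M.analytic_den e'), 1, fun θ hθ => ?_⟩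
  have hne := (map_ne_zero_iff (algebraMap ℝ[X] (RatFunc ℝ))
    (IsFractionRing.injective _ _)).2 ((M.denProd_ne_zero_iff θ).1 hθ e)
  rw [pow_one, ModelSet.denProd, ← Finset.mul_prod_erase _ _ (Finset.mem_univ e), map_mul,
    ModelSet.module]
  simp only [Pi.mul_apply, Finset.prod_apply, map_mul]
  field_simp

/-- A function of the edge weights that is affine in each weight and does not vanish identically
does not vanish at the modules of some parameter, by independence of the parameterization. -/
theorem ModelSet.exists_apply_module_ne_zero [DecidableEq (Edge 𝒢)]
    {F : (Edge 𝒢 → RatFunc ℝ) → RatFunc ℝ}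
    (hF : ∀ w e, ∃ α β : RatFunc ℝ, ∀ t, F (Function.update w e t) = α + t * β)
    {w₀ : Edge 𝒢 → RatFunc ℝ} (hw₀ : F w₀ ≠ 0) {θ₀ : Fin M.p → ℝ} (hθ₀ : θ₀ ∈ M.Θ) :
    ∃ θ ∈ M.U, M.denProd θ ≠ 0 ∧ F (fun e => M.module e θ) ≠ 0 := by
  have hθ₀U := M.Θ_subset hθ₀
  have hnhds : {θ | θ ∈ M.U ∧ M.denProd θ ≠ 0} ∈ 𝓝 θ₀ := by
    obtain ⟨m, hm⟩ : ∃ m, (M.denProd θ₀).coeff m ≠ 0 := by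
      by_contra! h
      exact (M.denProd_ne_zero_iff θ₀).2 (fun e => M.den_ne_zero e θ₀ hθ₀) (Polynomial.ext h)
    filter_upwards [M.isOpen_U.mem_nhds hθ₀U,
      (M.denProd_mem m θ₀ hθ₀U).continuousAt.eventually_ne hm] with θ h1 h2
    exact ⟨h1, fun h0 => h2 (by rw [h0, Polynomial.coeff_zero])⟩
  obtain ⟨r, hr, hball⟩ := Metric.mem_nhds_iff.1 hnhds
  choose a ha hane using fun e => M.exists_module_ne e hθ₀U (M.den_ne_zero e θ₀ hθ₀)
    (Metric.ball_mem_nhds θ₀ hr) fun θ hθ => (M.denProd_ne_zero_iff θ).1 (hball hθ).2 e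
  obtain ⟨w, hw, hFw⟩ := exists_ne_zero_of_affine hF hw₀ hane
  have hchoice : ∀ e, ∃ θ ∈ Metric.ball θ₀ r, w e = M.module e θ := fun e =>
    (hw e).elim (fun h => ⟨θ₀, Metric.mem_ball_self hr, h⟩) fun h => ⟨a e, ha e, h⟩
  choose c hc hcw using hchoice
  -- Each edge contributes its own block. Balls of the sup metric are products, so the assembled
  -- point stays in the ball, though perhaps not in `Θ`.
  let θ₁ : Fin M.p → ℝ := fun k => c (M.owner k) k
  have hθ₁ : θ₁ ∈ Metric.ball θ₀ r := by
    rw [Metric.mem_ball, dist_pi_lt_iff hr]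
    exact fun k => (dist_pi_lt_iff hr).1 (hc (M.owner k)) k
  have hθ₁w : (fun e => M.module e θ₁) = w := by
    ext1 e
    obtain ⟨h1, h2⟩ := M.independent e θ₁ (hball hθ₁).1 (c e) (hball (hc e)).1
      (by rintro k rfl; rfl)
    rw [hcw, ModelSet.module, ModelSet.module, h1, h2]
  exact ⟨θ₁, (hball hθ₁).1, (hball hθ₁).2, hθ₁w ▸ hFw⟩

variable [DecidableEq V]

theorem ModelSet.measuredTransfer_apply (R C : Finset V) (θ : Fin M.p → ℝ) (y : C) (r : R) :
    M.measuredTransfer R C θ y r = (1 - M.G θ)⁻¹ y r := by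
  simp [ModelSet.measuredTransfer, ModelSet.T, measurementMatrix, excitationMatrix,
    Matrix.mul_apply, Matrix.one_apply]

/-- Bordering avoids the inverse: all entries are constants or differ from constants by a module. -/
theorem ModelSet.det_bordered_mem {n : ℕ} (x y : Fin n → V) :
    (fun θ => (bordered (M.G θ) x y).det) ∈
      analyticFractions M.U M.denProd M.denProd_mem := by
  have hc : ∀ (P : Prop) [Decidable P], (fun _ => if P then (1 : RatFunc ℝ) else 0) ∈
      analyticFractions M.U M.denProd M.denProd_mem := fun P _ => by
    by_cases h : P
    · simp only [h, if_true]; exact one_mem _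
    · simp only [h, if_false]; exact zero_mem _
  refine det_mem_subring _ _ fun a b => ?_
  rcases a with a | a <;> rcases b with b | b
  · refine sub_mem (hc (a = b)) ?_
    by_cases h : 𝒢.Adj b a
    · have : (fun θ => M.G θ a b) = M.module ⟨(b, a), h⟩ := by
        ext1 θ
        simp [ModelSet.G, h]
      rw [this]
      exact M.module_mem _
    · have : (fun θ => M.G θ a b) = 0 := by
        ext1 θ
        simp [ModelSet.G, h]
      rw [this]
      exact zero_mem _
  · exact hc (a = x b)
  · exact hc (y a = b)
  · exact zero_mem _

/-- If there are `n` disjoint paths from `X` to `Y`, then a minor of order `n` of `[T]_{Y, X}` is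
generically nonzero. -/
theorem ModelSet.exists_minor_ae_ne_zero (hacyc : IsAcyclic 𝒢) {X Y : Finset V} {n : ℕ}
    (h : HasDisjointPaths 𝒢 X Y n) : ∃ x y : Fin n → V, Function.Injective x ∧
      Function.Injective y ∧ (∀ k, x k ∈ X) ∧ (∀ k, y k ∈ Y) ∧
      ∀ᵐ θ ∂(volume : Measure (Fin M.p → ℝ)), θ ∈ M.Θ →
        ((1 - M.G θ)⁻¹.submatrix y x).det ≠ 0 := by
  obtain ⟨x, y, hx, hy, hxX, hyY, w₀, hw₀⟩ := h.exists_det_ne_zero (RatFunc ℝ) hacyc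
  refine ⟨x, y, hx, hy, hxX, hyY, ?_⟩
  rcases M.Θ.eq_empty_or_nonempty with hΘ | ⟨θ₀, hθ₀⟩
  · simp only [hΘ, Set.mem_empty_iff_false, false_imp_iff, eventually_true]
  obtain ⟨θ₁, hU, hd, hF⟩ := M.exists_apply_module_ne_zero
    (F := fun w => (bordered (netMatrix 𝒢 w) x y).det) (det_bordered_affine x y)
    ((det_bordered_ne_zero_iff ((isNetworkMatrix_netMatrix 𝒢 w₀).isUnit_det hacyc) x y).2 hw₀) hθ₀
  have hae := ae_ne_zero_of_mem_analyticFractions volume M.isOpen_U M.isPreconnected_U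
    M.denProd_mem (M.det_bordered_mem x y) hU hd hF
  filter_upwards [hae] with θ hθ hθΘ
  exact (det_bordered_ne_zero_iff ((M.isNetworkMatrix_G θ).isUnit_det hacyc) x y).1
    (hθ (M.Θ_subset hθΘ) ((M.denProd_ne_zero_iff θ).2 fun e => M.den_ne_zero e θ hθΘ))

theorem ModelSet.ae_columnsIndep (hacyc : IsAcyclic 𝒢) {X Y : Finset V}
    (h : maxDisjointPaths 𝒢 X Y = X.card) :
    ∀ᵐ θ ∂(volume : Measure (Fin M.p → ℝ)), θ ∈ M.Θ → ColumnsIndep (1 - M.G θ)⁻¹ X Y := by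
  obtain ⟨x, y, hx, -, hxX, hyY, hae⟩ := M.exists_minor_ae_ne_zero hacyc
    (h ▸ hasDisjointPaths_maxDisjointPaths 𝒢 X Y)
  filter_upwards [hae] with θ hθ hθΘ
  exact .of_det_ne_zero hxX hyY hx rfl (hθ hθΘ)

theorem ModelSet.ae_rowsIndep (hacyc : IsAcyclic 𝒢) {X Y : Finset V}
    (h : maxDisjointPaths 𝒢 X Y = Y.card) :
    ∀ᵐ θ ∂(volume : Measure (Fin M.p → ℝ)), θ ∈ M.Θ → RowsIndep (1 - M.G θ)⁻¹ X Y := by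
  obtain ⟨x, y, -, hy, hxX, hyY, hae⟩ := M.exists_minor_ae_ne_zero hacyc
    (h ▸ hasDisjointPaths_maxDisjointPaths 𝒢 X Y)
  filter_upwards [hae] with θ hθ hθΘ
  exact .of_det_ne_zero hxX hyY hy rfl (hθ hθΘ)

end ModelSets

end DynNet

/-! ### Generic identifiability -/

theorem mainTheorem3 {V : Type*} [Fintype V] [DecidableEq V]
    (𝒢 : Digraph V) (hacyc : DynNet.IsAcyclic 𝒢)
    (M : DynNet.ModelSet 𝒢)
    (R C : Finset V) (hRC : R ∪ C = Finset.univ)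
    (h1 : ∀ j ∈ C,
      DynNet.maxDisjointPaths 𝒢 R (DynNet.inNbrs 𝒢 j) = (DynNet.inNbrs 𝒢 j).card)
    (h2 : ∀ j, j ∉ C → j ∈ R →
      ∃ Cj ⊆ C, ∃ Rj ⊆ R,
        DynNet.unexcitedInNbrs 𝒢 R j ⊆ Cj ∧ j ∈ Rj ∧
        DynNet.maxDisjointPaths 𝒢 Rj Cj = Rj.card ∧
        DynNet.maxDisjointPaths 𝒢 ((Rj ∪ DynNet.auxSet 𝒢 R j) \ {j}) Cj = Rj.card - 1) :
    M.GenericallyIdentifiable R C := by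
  have hR : ∀ j ∉ C, j ∈ R := fun j hj =>
    (Finset.mem_union.1 (hRC ▸ Finset.mem_univ j)).resolve_right hj
  have h2' := fun j hj => h2 j hj (hR j hj)
  choose Y hY X hX _ hjX hmax hex using h2'
  have hrows : ∀ᵐ θ ∂(MeasureTheory.volume : MeasureTheory.Measure (Fin M.p → ℝ)),
      ∀ j, ∀ _ : j ∈ C, θ ∈ M.Θ →
        DynNet.RowsIndep (1 - M.G θ)⁻¹ R (DynNet.inNbrs 𝒢 j) := by
    refine MeasureTheory.ae_all_iff.2 fun j => ?_
    by_cases hj : j ∈ C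
    · simpa [hj] using M.ae_rowsIndep hacyc (h1 j hj)
    · simp [hj]
  have hcols : ∀ᵐ θ ∂(MeasureTheory.volume : MeasureTheory.Measure (Fin M.p → ℝ)),
      ∀ j, ∀ hj : j ∉ C, θ ∈ M.Θ →
        DynNet.ColumnsIndep (1 - M.G θ)⁻¹ (X j hj) (Y j hj) := by
    refine MeasureTheory.ae_all_iff.2 fun j => ?_
    by_cases hj : j ∈ C
    · simp [hj]
    · simpa [hj] using M.ae_columnsIndep hacyc (hmax j hj)
  intro i j _
  filter_upwards [hrows, hcols] with θ₀ hr hc hθ₀ θ₁ _ hT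
  have hG := DynNet.eq_of_inv_eq hacyc (M.isNetworkMatrix_G θ₀) (M.isNetworkMatrix_G θ₁)
    (R := R) (C := C) (fun y hy r hr => by
      have h := congrFun (congrFun hT ⟨y, hy⟩) ⟨r, hr⟩
      rwa [M.measuredTransfer_apply, M.measuredTransfer_apply] at h)
    (fun j hj => hr j hj hθ₀)
    (fun j hj => ⟨Y j hj, hY j hj, X j hj, hX j hj, hjX j hj, hc j hj hθ₀, by
      -- Subtraction is truncated; strictness holds because `j` makes the set nonempty.
      rw [hex j hj]
      exact Nat.sub_lt (Finset.card_pos.2 ⟨j, hjX j hj⟩) one_pos⟩)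
  rw [hG]
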